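/- Let $R$ be a Gorenstein local ring (a Noetherian local ring of finite injective dimension over itself) with $\dim R=1$, and let $I\subseteq R$ be an ideal containing a regular element (a non-zero-divisor of $R$). Put $S=\operatorname{End}_R(I)$, let $S/R$ denote the cokernel of the homothety map $R\to S$, let $\omega_{R/I}$ be a canonical module of $R/I$ (it is the zero module if $I=R$), let $\operatorname{tr}_R(I)\supseteq I$ be the trace ideal of $I$, that is, the image of the evaluation map $\operatorname{Hom}_R(I,R)\otimes_R I\to R$, $f\otimes x\mapsto f(x)$, and write $\lambda_R$ for the length of an $R$-module. Then all lengths below are finite, and $$\lambda_R\big(\operatorname{Ext}^1_R(I,I)\big)+\lambda_R(R/I)=\lambda_R(S/R)+\lambda_R\big((I/I^2)\otimes_{R/I}\omega_{R/I}\big).$$ In particular, $I$ is rigid, i.e. $\operatorname{Ext}^1_R(I,I)=0$, if and only if $$\lambda_R(R/I)-\lambda_R(S/R)=\lambda_R\big((I/I^2)\otimes_{R/I}\omega_{R/I}\big),$$ if and only if $$\lambda_R\big(\operatorname{tr}_R(I)/I\big)=\lambda_R\big((I/I^2)\otimes_{R}\omega_{R/I}\big).$$ -/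

import Mathlib

open CategoryTheory Abelian

universe u

/-- A Gorenstein local ring: a Noetherian local ring of finite injective dimension over itself. -/
class IsGorensteinLocalRing (R : Type u) [CommRing R] : Prop where
  isLocalRing : IsLocalRing R
  isNoetherianRing : IsNoetherianRing R
  injectiveDimension_ne_top : injectiveDimension (ModuleCat.of R R) ≠ ⊤

/-- A module `M` is rigid if `Ext¹(M, M) = 0`. -/
def IsRigidModule (R : Type u) [CommRing R] (M : Type u) [AddCommGroup M] [Module R M] : Prop :=
  Subsingleton (Ext (ModuleCat.of R M) (ModuleCat.of R M) 1)

/-- The trace of `M`: the image of the evaluation map `M* ⊗ M → R`. -/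
noncomputable def traceIdeal (R : Type u) [CommRing R] (M : Type u) [AddCommGroup M]
    [Module R M] : Ideal R :=
  LinearMap.range (contractLeft R M)

/-- The quotient `S / R` of the endomorphism ring `S = End_R(I)` by the image of the
homothety map `R → S`. -/
abbrev EndQuotient (R : Type u) [CommRing R] (I : Ideal R) : Type u :=
  Module.End R I ⧸ LinearMap.range (Algebra.linearMap R (Module.End R I))

/-- A canonical module `C` over a Noetherian ring `A`: a finitely generated module of finite
injective dimension that is maximal Cohen-Macaulay of type one at every maximal ideal `m`, i.e.
the least `i` with `Ext^i(A/m, C) ≠ 0` is `dim A_m = height m`, and that `Ext` module is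
one-dimensional over `A/m`. For a local ring `m` is the maximal ideal; over the zero ring the
zero module is canonical. -/
structure IsCanonicalModule (A : Type u) [CommRing A] (C : Type u) [AddCommGroup C]
    [Module A C] : Prop where
  finite : Module.Finite A C
  injectiveDimension_ne_top : injectiveDimension (ModuleCat.of A C) ≠ ⊤
  subsingleton_ext : ∀ m : Ideal A, m.IsMaximal → ∀ i : ℕ, (i : ℕ∞) < m.height →
    Subsingleton (Ext (ModuleCat.of A (A ⧸ m)) (ModuleCat.of A C) i)
  length_ext : ∀ m : Ideal A, m.IsMaximal → ∀ i : ℕ, (i : ℕ∞) = m.height →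
    Module.length A (Ext (ModuleCat.of A (A ⧸ m)) (ModuleCat.of A C) i) = 1

/-! Write `I* = Hom(I, R)`. As `R/I` has finite length, `Ext²(R/I, R) = 0`, hence `Ext¹(I, R) = 0`.
Applying `Hom(I, -)` to `0 → I → R → R/I → 0` then gives `0 → S → I* → Hom(I, R/I) → Ext¹(I, I) →
0`. In the chain `R ⊆ S ⊆ I*` the total quotient `I*/R` is `Ext¹(R/I, R)`, of length `λ(R/I)` by
local duality, so `λ(I*/S) = λ(R/I) - λ(S/R)`. This is `length_ext_one_add_length_quotient`.

With `ω = ω_{R/I}`, `Hom(I, R/I) = Hom_{R/I}(I/I², Hom(ω, ω)) = Hom_{R/I}(I/I² ⊗ ω, ω)`, which has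
the length of `I/I² ⊗ ω` by Matlis duality over the Artinian ring `R/I`.

For the trace form, reflexivity of `I` identifies `S` with the dual of `tr(I)`, so `λ(S/R) =
λ(R/tr(I))` (`length_endQuotient`).

Both dualities come from one dévissage: on finite length modules `Ext^d(-, X)` multiplies length by
a constant as soon as the neighbouring `Ext`s of the residue field vanish. -/

/-! ### Long exact sequences of `Ext` in terms of lengths. -/

section ExtSequences

variable {R : Type u} [CommRing R]

/-- The short exact sequence in `ModuleCat R` attached to unbundled exactness data. -/
theorem moduleCat_shortExact {N₁ N₂ N₃ : Type u} [AddCommGroup N₁] [Module R N₁]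
    [AddCommGroup N₂] [Module R N₂] [AddCommGroup N₃] [Module R N₃]
    {f : N₁ →ₗ[R] N₂} {g : N₂ →ₗ[R] N₃} (hf : Function.Injective f)
    (hg : Function.Surjective g) (H : Function.Exact f g) :
    (ModuleCat.shortComplexOfCompEqZero f g H.linearMap_comp_eq_zero).ShortExact :=
  ModuleCat.shortComplex_shortExact _ H hf hg

/-- A linear equivalence induces an equivalence of `Ext` modules in the first variable. -/
noncomputable def extCongrLeft {M N : Type u} [AddCommGroup M] [Module R M]
    [AddCommGroup N] [Module R N] (e : M ≃ₗ[R] N) (X : ModuleCat.{u} R) (n : ℕ) :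
    Ext (ModuleCat.of R N) X n ≃ₗ[R] Ext (ModuleCat.of R M) X n :=
  LinearEquiv.ofLinearMap
    (Ext.precompOfLinear (Ext.mk₀ e.toModuleIso.hom) R X (zero_add n))
    (Ext.precompOfLinear (Ext.mk₀ e.toModuleIso.inv) R X (zero_add n))
    (by ext x; simp [-LinearEquiv.toModuleIso_hom, -LinearEquiv.toModuleIso_inv])
    (by ext x; simp [-LinearEquiv.toModuleIso_hom, -LinearEquiv.toModuleIso_inv])

/-- `Ext⁰` is `Hom`. -/
noncomputable def extZeroLinearEquiv (M N : Type u) [AddCommGroup M] [Module R M]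
    [AddCommGroup N] [Module R N] :
    Ext (ModuleCat.of R M) (ModuleCat.of R N) 0 ≃ₗ[R] (M →ₗ[R] N) :=
  Ext.linearEquiv₀ ≪≫ₗ
    ModuleCat.homLinearEquiv (S := R) (M := ModuleCat.of R M) (N := ModuleCat.of R N)

variable {N₁ N₂ N₃ : Type u} [AddCommGroup N₁] [Module R N₁]
  [AddCommGroup N₂] [Module R N₂] [AddCommGroup N₃] [Module R N₃]
  {f : N₁ →ₗ[R] N₂} {g : N₂ →ₗ[R] N₃}

theorem subsingleton_ext_left (hf : Function.Injective f) (hg : Function.Surjective g)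
    (H : Function.Exact f g) (X : ModuleCat.{u} R) (n : ℕ)
    (h₂ : Subsingleton (Ext (ModuleCat.of R N₂) X n))
    (h₃ : Subsingleton (Ext (ModuleCat.of R N₃) X (n + 1))) :
    Subsingleton (Ext (ModuleCat.of R N₁) X n) := by
  refine subsingleton_of_forall_eq 0 fun x => ?_
  obtain ⟨y, hy⟩ := Ext.contravariant_sequence_exact₁ (moduleCat_shortExact hf hg H) X x
    (add_comm 1 n) (h₃.elim _ _)
  rw [← hy, h₂.elim y 0]
  exact Ext.comp_zero ..

theorem subsingleton_ext_middle (hf : Function.Injective f) (hg : Function.Surjective g)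
    (H : Function.Exact f g) (X : ModuleCat.{u} R) (n : ℕ)
    (h₁ : Subsingleton (Ext (ModuleCat.of R N₁) X n))
    (h₃ : Subsingleton (Ext (ModuleCat.of R N₃) X n)) :
    Subsingleton (Ext (ModuleCat.of R N₂) X n) := by
  refine subsingleton_of_forall_eq 0 fun x => ?_
  obtain ⟨y, hy⟩ := Ext.contravariant_sequence_exact₂ (moduleCat_shortExact hf hg H) X x
    (h₁.elim _ _)
  rw [← hy, h₃.elim y 0]
  exact Ext.comp_zero ..

theorem subsingleton_ext_right (hf : Function.Injective f) (hg : Function.Surjective g)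
    (H : Function.Exact f g) (X : ModuleCat.{u} R) (n : ℕ)
    (h₁ : Subsingleton (Ext (ModuleCat.of R N₁) X n))
    (h₂ : Subsingleton (Ext (ModuleCat.of R N₂) X (n + 1))) :
    Subsingleton (Ext (ModuleCat.of R N₃) X (n + 1)) := by
  refine subsingleton_of_forall_eq 0 fun x => ?_
  obtain ⟨y, hy⟩ := Ext.contravariant_sequence_exact₃ (moduleCat_shortExact hf hg H) X x
    (h₂.elim _ _) (add_comm 1 n)
  rw [← hy, h₁.elim y 0]
  exact Ext.comp_zero ..

/-- Additivity of the length of `Ext^n` when the neighbouring terms vanish. -/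
theorem length_ext_add (hf : Function.Injective f) (hg : Function.Surjective g)
    (H : Function.Exact f g) (X : ModuleCat.{u} R) (n : ℕ)
    (h₁ : ∀ m, m < n → Subsingleton (Ext (ModuleCat.of R N₁) X m))
    (h₃ : Subsingleton (Ext (ModuleCat.of R N₃) X (n + 1))) :
    Module.length R (Ext (ModuleCat.of R N₂) X n) =
      Module.length R (Ext (ModuleCat.of R N₃) X n) +
        Module.length R (Ext (ModuleCat.of R N₁) X n) := by
  have hS := moduleCat_shortExact hf hg H
  refine Module.length_eq_add_of_exact
    (Ext.precompOfLinear (Ext.mk₀ (ModuleCat.ofHom g)) R X (zero_add n))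
    (Ext.precompOfLinear (Ext.mk₀ (ModuleCat.ofHom f)) R X (zero_add n)) ?_ ?_ ?_
  -- In degree `0` this is left exactness of `Hom`; in higher degrees the preceding term
  -- `Ext^(n-1)(N₁, X)` vanishes by `h₁`.
  · cases n with
    | zero =>
      have : Epi (ModuleCat.ofHom g) := (ModuleCat.epi_iff_surjective _).mpr hg
      exact Ext.precomp_mk₀_injective_of_epi X (ModuleCat.ofHom g)
    | succ n =>
      refine (injective_iff_map_eq_zero _).mpr fun x hx => ?_
      obtain ⟨y, hy⟩ := Ext.contravariant_sequence_exact₃ hS X x hx (add_comm 1 n)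
      rw [← hy, (h₁ n n.lt_succ_self).elim y 0]
      exact Ext.comp_zero ..
  · exact fun x => Ext.contravariant_sequence_exact₁ hS X x (add_comm 1 n) (h₃.elim _ _)
  · exact (ShortComplex.ab_exact_iff_function_exact _).mp
      (Ext.contravariant_sequence_exact₂' hS X n)

/-- If `Ext¹(N₂, Y) = 0`, then `Ext¹(N₃, Y)` is the cokernel of `Hom(N₂, Y) → Hom(N₁, Y)`. -/
theorem length_ext_one_eq_length_lcomp_coker (hf : Function.Injective f)
    (hg : Function.Surjective g) (H : Function.Exact f g)
    (Y : Type u) [AddCommGroup Y] [Module R Y]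
    (h₂ : Subsingleton (Ext (ModuleCat.of R N₂) (ModuleCat.of R Y) 1)) :
    Module.length R (Ext (ModuleCat.of R N₃) (ModuleCat.of R Y) 1) =
      Module.length R ((N₁ →ₗ[R] Y) ⧸ LinearMap.range (LinearMap.lcomp R Y f)) := by
  have hS := moduleCat_shortExact hf hg H
  let e : (N₁ →ₗ[R] Y) ≃ₗ[R] Ext (ModuleCat.of R N₁) (ModuleCat.of R Y) 0 :=
    (extZeroLinearEquiv N₁ Y).symm
  let δ : (N₁ →ₗ[R] Y) →ₗ[R] Ext (ModuleCat.of R N₃) (ModuleCat.of R Y) 1 :=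
    (Ext.precompOfLinear hS.extClass R (ModuleCat.of R Y) (add_zero 1)) ∘ₗ e.toLinearMap
  have hδ : Function.Surjective δ := by
    intro x
    obtain ⟨y, hy⟩ := Ext.contravariant_sequence_exact₃ hS (ModuleCat.of R Y) x
      (h₂.elim _ _) (add_zero 1)
    exact ⟨e.symm y, by simpa [δ] using hy⟩
  have hker : LinearMap.ker δ = LinearMap.range (LinearMap.lcomp R Y f) := by
    ext φ
    constructor
    · intro hφ
      obtain ⟨y, hy⟩ := Ext.contravariant_sequence_exact₁ hS (ModuleCat.of R Y) (e φ)
        (add_zero 1) hφ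
      obtain ⟨ψ, rfl⟩ := Ext.linearEquiv₀ (R := R).symm.surjective y
      refine ⟨ψ.hom, e.injective ?_⟩
      rw [← hy]
      simp [e, extZeroLinearEquiv]
      rfl
    · rintro ⟨ψ, rfl⟩
      have : e (LinearMap.lcomp R Y f ψ) = (Ext.mk₀ (ModuleCat.ofHom f)).comp
          (Ext.mk₀ (ModuleCat.ofHom ψ)) (zero_add 0) := by
        simp [e, extZeroLinearEquiv]
        rfl
      change hS.extClass.comp (e _) (add_zero 1) = 0
      rw [this]
      exact hS.extClass_comp_assoc _
  rw [← hker]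
  exact (δ.quotKerEquivOfSurjective hδ).length_eq.symm

/-- If `Ext¹(M, N₂) = 0`, then `Ext¹(M, N₁)` is the cokernel of `Hom(M, N₂) → Hom(M, N₃)`. -/
theorem length_ext_one_eq_length_compRight_coker (hf : Function.Injective f)
    (hg : Function.Surjective g) (H : Function.Exact f g)
    (M : Type u) [AddCommGroup M] [Module R M]
    (h₂ : Subsingleton (Ext (ModuleCat.of R M) (ModuleCat.of R N₂) 1)) :
    Module.length R (Ext (ModuleCat.of R M) (ModuleCat.of R N₁) 1) =
      Module.length R ((M →ₗ[R] N₃) ⧸ LinearMap.range (LinearMap.compRight R (M := M) g)) := by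
  have hS := moduleCat_shortExact hf hg H
  let e : (M →ₗ[R] N₃) ≃ₗ[R] Ext (ModuleCat.of R M) (ModuleCat.of R N₃) 0 :=
    (extZeroLinearEquiv M N₃).symm
  let δ : (M →ₗ[R] N₃) →ₗ[R] Ext (ModuleCat.of R M) (ModuleCat.of R N₁) 1 :=
    (Ext.postcompOfLinear hS.extClass R (ModuleCat.of R M) (zero_add 1)) ∘ₗ e.toLinearMap
  have hδ : Function.Surjective δ := by
    intro x
    obtain ⟨y, hy⟩ := Ext.covariant_sequence_exact₁ (ModuleCat.of R M) hS x
      (h₂.elim _ _) (zero_add 1)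
    exact ⟨e.symm y, by simpa [δ] using hy⟩
  have hker : LinearMap.ker δ = LinearMap.range (LinearMap.compRight R (M := M) g) := by
    ext φ
    constructor
    · intro hφ
      obtain ⟨y, hy⟩ := Ext.covariant_sequence_exact₃ (ModuleCat.of R M) hS (e φ)
        (zero_add 1) hφ
      obtain ⟨ψ, rfl⟩ := Ext.linearEquiv₀ (R := R).symm.surjective y
      refine ⟨ψ.hom, e.injective ?_⟩
      rw [← hy]
      simp [e, extZeroLinearEquiv]
      rfl
    · rintro ⟨ψ, rfl⟩
      have : e (LinearMap.compRight R g ψ) = (Ext.mk₀ (ModuleCat.ofHom ψ)).comp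
          (Ext.mk₀ (ModuleCat.ofHom g)) (zero_add 0) := by
        simp [e, extZeroLinearEquiv]
        rfl
      change (e _).comp hS.extClass (zero_add 1) = 0
      rw [this]
      refine (Ext.comp_assoc_of_second_deg_zero ..).trans ?_
      refine (congrArg (fun z => (Ext.mk₀ (ModuleCat.ofHom ψ)).comp z (zero_add 1))
        hS.comp_extClass).trans ?_
      exact Ext.comp_zero ..
  rw [← hker]
  exact (δ.quotKerEquivOfSurjective hδ).length_eq.symm

end ExtSequences

/-! ### Dévissage to the residue field. -/

section Devissage

variable {R : Type u} [CommRing R]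

theorem subsingleton_ext_of_subsingleton (N : Type u) [AddCommGroup N] [Module R N]
    [Subsingleton N] (X : ModuleCat.{u} R) (n : ℕ) :
    Subsingleton (Ext (ModuleCat.of R N) X n) := by
  refine subsingleton_of_forall_eq 0 fun x => ?_
  have h : 𝟙 (ModuleCat.of R N) = 0 :=
    (Limits.IsZero.iff_id_eq_zero _).mp (ModuleCat.isZero_of_subsingleton _)
  rw [← Ext.mk₀_id_comp x, h, Ext.mk₀_zero, Ext.zero_comp]

theorem nonempty_equiv_quotient_maximalIdeal [IsLocalRing R] (M : Type*) [AddCommGroup M]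
    [Module R M] [IsSimpleModule R M] :
    Nonempty (M ≃ₗ[R] R ⧸ IsLocalRing.maximalIdeal R) := by
  obtain ⟨I, hI, ⟨e⟩⟩ := isSimpleModule_iff_quot_maximal.mp ‹IsSimpleModule R M›
  rw [IsLocalRing.eq_maximalIdeal hI] at e
  exact ⟨e⟩

variable [IsLocalRing R] (X : ModuleCat.{u} R)

theorem subsingleton_ext_of_isFiniteLength (n : ℕ)
    (h : Subsingleton (Ext (ModuleCat.of R (R ⧸ IsLocalRing.maximalIdeal R)) X n))
    {N : Type u} [AddCommGroup N] [Module R N] (hN : IsFiniteLength R N) :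
    Subsingleton (Ext (ModuleCat.of R N) X n) := by
  induction hN with
  | of_subsingleton => exact subsingleton_ext_of_subsingleton _ X n
  | @of_simple_quotient M _ _ N _ _ ih =>
    obtain ⟨e⟩ := nonempty_equiv_quotient_maximalIdeal (R := R) (M ⧸ N)
    exact subsingleton_ext_middle N.injective_subtype N.mkQ_surjective
      (LinearMap.exact_subtype_mkQ N) X n ih (extCongrLeft e X n).symm.subsingleton

/-- The vanishing passes from the residue field to all modules of finite length, so `Ext^d(-, X)` is
exact on them and each composition factor contributes the same length. -/
theorem length_ext_eq_mul (d : ℕ)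
    (hlt : ∀ m, m < d →
      Subsingleton (Ext (ModuleCat.of R (R ⧸ IsLocalRing.maximalIdeal R)) X m))
    (hgt : Subsingleton (Ext (ModuleCat.of R (R ⧸ IsLocalRing.maximalIdeal R)) X (d + 1)))
    {N : Type u} [AddCommGroup N] [Module R N] (hN : IsFiniteLength R N) :
    Module.length R (Ext (ModuleCat.of R N) X d) =
      Module.length R (Ext (ModuleCat.of R (R ⧸ IsLocalRing.maximalIdeal R)) X d) *
        Module.length R N := by
  induction hN with
  | @of_subsingleton M =>
    have := subsingleton_ext_of_subsingleton M X d
    simp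
  | @of_simple_quotient M _ _ N _ hN ih =>
    obtain ⟨e⟩ := nonempty_equiv_quotient_maximalIdeal (R := R) (M ⧸ N)
    rw [length_ext_add N.injective_subtype N.mkQ_surjective (LinearMap.exact_subtype_mkQ N) X d
      (fun m hm => subsingleton_ext_of_isFiniteLength X m (hlt m hm) hN)
      (extCongrLeft e X (d + 1)).symm.subsingleton,
      Module.length_eq_add_of_exact N.subtype N.mkQ N.injective_subtype N.mkQ_surjective
        (LinearMap.exact_subtype_mkQ N), ih, ← (extCongrLeft e X d).length_eq,
      Module.length_eq_one R (M ⧸ N), mul_add, mul_one, add_comm]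

/-- Over a local ring, if a module `X` of finite injective dimension satisfies `Ext^j(B, X) = 0`
for all `j ≥ d` and some nonzero `B` of finite length, then the same holds for all modules of
finite length. -/
theorem subsingleton_ext_of_injectiveDimension_ne_top (hX : injectiveDimension X ≠ ⊤)
    (B : Type u) [AddCommGroup B] [Module R B] [Nontrivial B] (hB : IsFiniteLength R B) (d : ℕ)
    (h : ∀ j, d ≤ j → Subsingleton (Ext (ModuleCat.of R B) X j)) (j : ℕ) (hj : d ≤ j)
    {N : Type u} [AddCommGroup N] [Module R N] (hN : IsFiniteLength R N) :
    Subsingleton (Ext (ModuleCat.of R N) X j) := by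
  obtain ⟨n, hn⟩ := (injectiveDimension_ne_top_iff X).mp hX
  -- Descending induction on `j`, with `t` bounding the distance to the range above the injective
  -- dimension.
  suffices H : ∀ t j, d ≤ j → n + 1 ≤ j + t →
      Subsingleton (Ext (ModuleCat.of R (R ⧸ IsLocalRing.maximalIdeal R)) X j) from
    subsingleton_ext_of_isFiniteLength X j (H (n + 1) j hj (by lia)) hN
  intro t
  induction t with
  | zero => exact fun j _ hj => HasInjectiveDimensionLT.subsingleton X (n + 1) j hj _
  | succ t ih =>
    intro j hdj hj
    have := (isFiniteLength_iff_isNoetherian_isArtinian.mp hB).2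
    -- A simple `K ⊆ B` is the residue field, and `Ext^j(K, X)` sits between `Ext^j(B, X) = 0` and
    -- `Ext^(j+1)(B/K, X)`, which vanishes by induction.
    obtain ⟨K, hK, -⟩ := (eq_bot_or_exists_atom_le (⊤ : Submodule R B)).resolve_left top_ne_bot
    have := isSimpleModule_iff_isAtom.mpr hK
    obtain ⟨e⟩ := nonempty_equiv_quotient_maximalIdeal (R := R) K
    have hC : IsFiniteLength R (B ⧸ K) := hB.of_surjective K.mkQ_surjective
    have := subsingleton_ext_left K.injective_subtype K.mkQ_surjective
      (LinearMap.exact_subtype_mkQ K) X j (h j hdj)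
      (subsingleton_ext_of_isFiniteLength X (j + 1) (ih (j + 1) (by lia) (by lia)) hC)
    exact (extCongrLeft e X j).subsingleton

end Devissage

theorem ENat.eq_one_of_self_eq_mul {r a : ℕ∞} (h0 : a ≠ 0) (ht : a ≠ ⊤) (h : a = r * a) :
    r = 1 := by
  induction r with
  | top => exact absurd (h.trans (ENat.top_mul h0)) ht
  | coe r =>
    lift a to ℕ using ht
    norm_cast at h h0 ⊢
    exact (Nat.eq_of_mul_eq_mul_right (Nat.pos_of_ne_zero h0) (by lia : 1 * a = r * a)).symm

/-! ### Local duality for `Ext¹(-, R)`. -/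

section GorensteinDual

open nonZeroDivisors

variable {R : Type u} [CommRing R] {x : R}

theorem subsingleton_ext_ring (X : ModuleCat.{u} R) (n : ℕ) :
    Subsingleton (Ext (ModuleCat.of R R) X (n + 1)) := by
  have : Projective (ModuleCat.of R R) := ModuleCat.projective_of_free (Module.Basis.singleton Unit R)
  exact Ext.subsingleton_of_projective (ModuleCat.of R R) X n

theorem exact_mulLeft_mkQ (x : R) :
    Function.Exact (LinearMap.mulLeft R x) (Ideal.span {x} : Submodule R R).mkQ := by
  intro y
  simp [Ideal.Quotient.eq_zero_iff_mem, Ideal.mem_span_singleton', mul_comm, Set.mem_range]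

theorem subsingleton_ext_quotient_span_singleton (hx : x ∈ R⁰) (X : ModuleCat.{u} R) (n : ℕ) :
    Subsingleton (Ext (ModuleCat.of R (R ⧸ Ideal.span {x})) X (n + 2)) :=
  subsingleton_ext_right (f := LinearMap.mulLeft R x)
    (fun _ _ h => (mul_cancel_left_mem_nonZeroDivisors hx).mp h)
    (Submodule.mkQ_surjective (Ideal.span {x})) (exact_mulLeft_mkQ x) X (n + 1)
    (subsingleton_ext_ring X n) (subsingleton_ext_ring X (n + 1))

theorem length_ext_one_quotient_span_singleton (hx : x ∈ R⁰) :
    Module.length R (Ext (ModuleCat.of R (R ⧸ Ideal.span {x})) (ModuleCat.of R R) 1) =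
      Module.length R (R ⧸ Ideal.span {x}) := by
  rw [length_ext_one_eq_length_lcomp_coker (f := LinearMap.mulLeft R x)
    (fun _ _ h => (mul_cancel_left_mem_nonZeroDivisors hx).mp h)
    (Submodule.mkQ_surjective (Ideal.span {x})) (exact_mulLeft_mkQ x) R
    (subsingleton_ext_ring _ 0)]
  refine (Submodule.Quotient.equiv _ _ (LinearMap.ringLmapEquivSelf R R R) ?_).length_eq
  ext y
  simp only [Submodule.mem_map, LinearMap.mem_range, Ideal.mem_span_singleton']
  constructor
  · rintro ⟨_, ⟨ψ, rfl⟩, rfl⟩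
    exact ⟨ψ 1, by simpa [mul_comm] using (ψ.map_smul x 1).symm⟩
  · rintro ⟨a, rfl⟩
    exact ⟨_, ⟨LinearMap.mulLeft R a, rfl⟩, by simp⟩

variable [IsLocalRing R] (hR : injectiveDimension (ModuleCat.of R R) ≠ ⊤) (hx : x ∈ R⁰)
  (hxm : x ∈ IsLocalRing.maximalIdeal R) (hfl : IsFiniteLength R (R ⧸ Ideal.span {x}))

include hx hxm in
theorem subsingleton_ext_zero_residueField :
    Subsingleton (Ext (ModuleCat.of R (R ⧸ IsLocalRing.maximalIdeal R)) (ModuleCat.of R R) 0) := by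
  have : Subsingleton ((R ⧸ IsLocalRing.maximalIdeal R) →ₗ[R] R) := by
    refine subsingleton_of_forall_eq 0 fun φ => LinearMap.ext fun y => ?_
    refine (mul_left_mem_nonZeroDivisors_eq_zero_iff hx).mp ?_
    have hy : x • y = 0 := by
      obtain ⟨y, rfl⟩ := Ideal.Quotient.mk_surjective y
      exact Ideal.Quotient.eq_zero_iff_mem.mpr (Ideal.mul_mem_right _ _ hxm)
    rw [← smul_eq_mul, ← map_smul, hy, map_zero]
  exact (extZeroLinearEquiv _ _).subsingleton

include hR hx hxm hfl in
-- The test module is `R/(x)`: it has projective dimension at most one, so its `Ext`s vanish from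
-- degree `2` on.
theorem subsingleton_ext_add_two {N : Type u} [AddCommGroup N] [Module R N]
    (hN : IsFiniteLength R N) (n : ℕ) :
    Subsingleton (Ext (ModuleCat.of R N) (ModuleCat.of R R) (n + 2)) := by
  have : Nontrivial (R ⧸ Ideal.span {x}) := Ideal.Quotient.nontrivial_iff.mpr fun h =>
    (IsLocalRing.mem_maximalIdeal x).mp hxm (Ideal.span_singleton_eq_top.mp h)
  refine subsingleton_ext_of_injectiveDimension_ne_top _ hR (R ⧸ Ideal.span {x}) hfl 2
    (fun j hj => ?_) (n + 2) (by lia) hN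
  obtain ⟨k, rfl⟩ := Nat.exists_eq_add_of_le' hj
  exact subsingleton_ext_quotient_span_singleton hx _ k

include hR hx hxm hfl in
/-- Local duality in dimension one: `Ext¹(-, R)` preserves lengths. -/
theorem length_ext_one_eq {N : Type u} [AddCommGroup N] [Module R N]
    (hN : IsFiniteLength R N) :
    Module.length R (Ext (ModuleCat.of R N) (ModuleCat.of R R) 1) = Module.length R N := by
  have hk : IsFiniteLength R (R ⧸ IsLocalRing.maximalIdeal R) :=
    hfl.of_surjective (f := Submodule.factor (p := Ideal.span {x})
      (p' := IsLocalRing.maximalIdeal R) (by simpa [Ideal.span_le] using hxm))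
      (Submodule.factor_surjective _)
  have : Nontrivial (R ⧸ Ideal.span {x}) := Ideal.Quotient.nontrivial_iff.mpr fun h =>
    (IsLocalRing.mem_maximalIdeal x).mp hxm (Ideal.span_singleton_eq_top.mp h)
  have key {N : Type u} [AddCommGroup N] [Module R N] (hN : IsFiniteLength R N) :=
    length_ext_eq_mul (ModuleCat.of R R) 1
      (fun m hm => by
        obtain rfl : m = 0 := by lia
        exact subsingleton_ext_zero_residueField hx hxm)
      (subsingleton_ext_add_two hR hx hxm hfl hk 0) hN
  -- The multiplier is found by evaluating at `R/(x)`, whose `Ext¹` into `R` is computed directly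
  -- and has the length of `R/(x)`; it must be `1`.
  have h1 := key hfl
  rw [length_ext_one_quotient_span_singleton hx] at h1
  have h2 : Module.length R (R ⧸ Ideal.span {x}) ≠ ⊤ := Module.length_ne_top_iff.mpr hfl
  have h3 : Module.length R (R ⧸ Ideal.span {x}) ≠ 0 := Module.length_pos.ne'
  have h4 : Module.length R (Ext (ModuleCat.of R (R ⧸ IsLocalRing.maximalIdeal R))
      (ModuleCat.of R R) 1) = 1 := by
    exact ENat.eq_one_of_self_eq_mul h3 h2 h1
  rw [key hN, h4, one_mul]

end GorensteinDual

/-! ### Matlis duality over an Artinian local ring. -/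

theorem LinearMap.bijective_of_injective_of_length_eq {R M N : Type*} [Ring R] [AddCommGroup M]
    [Module R M] [AddCommGroup N] [Module R N] (f : M →ₗ[R] N) (hf : Function.Injective f)
    (hM : Module.length R M ≠ ⊤) (h : Module.length R M = Module.length R N) :
    Function.Bijective f := by
  refine ⟨hf, ?_⟩
  have h1 := Module.length_eq_add_of_exact f (LinearMap.range f).mkQ hf
    (Submodule.mkQ_surjective _) (LinearMap.exact_map_mkQ_range f)
  rw [← h] at h1
  have h2 : Module.length R (N ⧸ LinearMap.range f) = 0 :=
    ENat.add_right_injective_of_ne_top hM ((add_zero _).trans h1).symm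
  rw [Module.length_eq_zero_iff, Submodule.Quotient.subsingleton_iff] at h2
  exact LinearMap.range_eq_top.mp h2

theorem isFiniteLength_of_finite (A : Type*) [CommRing A] [IsArtinianRing A] (N : Type*)
    [AddCommGroup N] [Module A N] [Module.Finite A N] : IsFiniteLength A N :=
  isFiniteLength_iff_isNoetherian_isArtinian.mpr ⟨inferInstance, inferInstance⟩

namespace IsCanonicalModule

variable {A : Type u} [CommRing A] [IsArtinianRing A] [IsLocalRing A]
  {C : Type u} [AddCommGroup C] [Module A C] (hC : IsCanonicalModule A C)

include hC

/-- Matlis duality: over an Artinian local ring, `Hom(-, C)` preserves lengths. -/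
theorem length_hom_eq {N : Type u} [AddCommGroup N] [Module A N] (hN : IsFiniteLength A N) :
    Module.length A (N →ₗ[A] C) = Module.length A N := by
  have hA : IsFiniteLength A A := isFiniteLength_of_finite A A
  -- Here the test module is `A` itself, which is free and of finite length; hence the bound on
  -- degrees is `1`.
  have h1 := length_ext_eq_mul (ModuleCat.of A C) 0 (by lia)
    (subsingleton_ext_of_injectiveDimension_ne_top _ hC.injectiveDimension_ne_top A hA 1
      (fun j hj => by
        obtain ⟨k, rfl⟩ := Nat.exists_eq_add_of_le' hj
        exact subsingleton_ext_ring _ k) 1 le_rfl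
      (isFiniteLength_of_finite A (A ⧸ IsLocalRing.maximalIdeal A))) hN
  have h0 : (IsLocalRing.maximalIdeal A).height = 0 := by
    rw [Ideal.height_eq_zero_iff]
    exact Ring.KrullDimLE.mem_minimalPrimes_iff.mpr ⟨inferInstance, bot_le⟩
  rw [hC.length_ext _ inferInstance 0 (by simp [h0]), one_mul] at h1
  rw [← h1]
  exact (extZeroLinearEquiv N C).length_eq.symm

omit [IsLocalRing A] in
theorem isFiniteLength : IsFiniteLength A C :=
  have := hC.finite
  isFiniteLength_of_finite A C

theorem length_eq : Module.length A C = Module.length A A := by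
  rw [← hC.length_hom_eq (isFiniteLength_of_finite A A)]
  exact (LinearMap.ringLmapEquivSelf A A C).length_eq.symm

/-- If `a` kills `C`, then `Hom(A/(a), C) = Hom(A, C)`, so `A/(a)` and `A` have equal length and `a
= 0`. Surjectivity is a count: `Hom(C, C)`, `C` and `A` have the same length. -/
theorem homothety_bijective : Function.Bijective (LinearMap.lsmul A C) := by
  have hA : Module.length A A ≠ ⊤ := Module.length_ne_top
  refine LinearMap.bijective_of_injective_of_length_eq _ ?_ hA ?_
  · refine (injective_iff_map_eq_zero _).mpr fun a ha => ?_
    have ha' : ∀ c : C, a • c = 0 := fun c => LinearMap.congr_fun ha c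
    let q := (Ideal.span {a} : Submodule A A).mkQ
    have h1 : Module.length A ((A ⧸ Ideal.span {a}) →ₗ[A] C) = Module.length A A := by
      rw [← hC.length_hom_eq (isFiniteLength_of_finite A A)]
      refine (LinearEquiv.ofBijective (LinearMap.lcomp A C q) ⟨?_, fun φ => ?_⟩).length_eq
      · exact LinearMap.lcomp_injective_of_surjective _ (Submodule.mkQ_surjective _)
      · have hφ : Ideal.span {a} ≤ LinearMap.ker φ := by
          rw [Ideal.span, Submodule.span_le]
          rintro _ rfl
          have := ha' (φ 1)
          rw [← map_smul, smul_eq_mul, mul_one] at this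
          simpa using this
        exact ⟨Submodule.liftQ _ φ hφ, Submodule.liftQ_mkQ _ φ hφ⟩
    rw [hC.length_hom_eq (isFiniteLength_of_finite A _)] at h1
    have h2 := Module.length_eq_add_of_exact (Submodule.subtype (Ideal.span {a})) q
      (Submodule.injective_subtype _) (Submodule.mkQ_surjective _) (LinearMap.exact_subtype_mkQ _)
    rw [h1] at h2
    have h3 : Module.length A (Ideal.span {a}) = 0 :=
      ENat.add_left_injective_of_ne_top hA ((zero_add _).trans h2).symm
    rw [Module.length_eq_zero_iff, Submodule.subsingleton_iff_eq_bot,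
      Ideal.span_singleton_eq_bot] at h3
    exact h3
  · rw [hC.length_hom_eq hC.isFiniteLength, hC.length_eq]

/-- The dual `Hom(M, A)` has the same length as `M ⊗ C`. -/
theorem length_dual_eq_length_tensorProduct (M : Type u) [AddCommGroup M] [Module A M]
    [Module.Finite A M] :
    Module.length A (M →ₗ[A] A) = Module.length A (TensorProduct A M C) := by
  have := hC.finite
  rw [← hC.length_hom_eq (isFiniteLength_of_finite A (TensorProduct A M C))]
  -- `Hom(M, A) ≅ Hom(M, Hom(C, C)) ≅ Hom(M ⊗ C, C)`.
  exact (LinearEquiv.congrRight (LinearEquiv.ofBijective _ hC.homothety_bijective) ≪≫ₗ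
    TensorProduct.lift.equiv (.id A) M C C).length_eq

end IsCanonicalModule

/-! ### The dual of the conormal module. -/

section Cotangent

variable {R : Type*} [CommRing R] (I : Ideal R)

/-- Homomorphisms `I → R / I` are the `R / I`-linear maps on the conormal module `I / I²`. -/
noncomputable def cotangentDualEquiv :
    (I.Cotangent →ₗ[R ⧸ I] (R ⧸ I)) ≃ₗ[R] (I →ₗ[R] R ⧸ I) :=
  LinearEquiv.ofBijective
    { toFun φ := (φ.restrictScalars R).comp I.toCotangent
      map_add' _ _ := rfl
      map_smul' _ _ := rfl }
    ⟨fun φ ψ h => by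
      ext y
      obtain ⟨y, rfl⟩ := I.toCotangent_surjective y
      exact LinearMap.congr_fun h y, fun φ => by
      have h : (I • ⊤ : Submodule R I) ≤ LinearMap.ker φ := by
        rw [Submodule.smul_le]
        intro r hr n _
        obtain ⟨z, hz⟩ := Ideal.Quotient.mk_surjective (φ n)
        rw [LinearMap.mem_ker, map_smul, ← hz]
        exact Ideal.Quotient.eq_zero_iff_mem.mpr (Ideal.mul_mem_right _ _ hr)
      let ψ : I.Cotangent →ₗ[R] R ⧸ I := Submodule.liftQ _ φ h
      exact ⟨ψ.extendScalarsOfSurjective (S := R ⧸ I) Ideal.Quotient.mk_surjective, rfl⟩⟩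

end Cotangent

/-! ### Lengths of quotients. -/

section QuotientLength

variable {R : Type*} [Ring R] {M N : Type*} [AddCommGroup M] [Module R M] [AddCommGroup N]
  [Module R N]

/-- `f` embeds `M / f⁻¹(Q)` into `N / Q` with cokernel `N / range f`. -/
theorem length_quotient_comap_add (f : M →ₗ[R] N) (Q : Submodule R N)
    (h : Q ≤ LinearMap.range f) :
    Module.length R (M ⧸ Q.comap f) + Module.length R (N ⧸ LinearMap.range f) =
      Module.length R (N ⧸ Q) := by
  refine (Module.length_eq_add_of_exact ((Q.comap f).mapQ Q f le_rfl) (Submodule.factor h)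
    ?_ (Submodule.factor_surjective h) ?_).symm
  · rw [← LinearMap.ker_eq_bot, Submodule.ker_mapQ, Submodule.mkQ_map_self]
  · rw [LinearMap.exact_iff, Submodule.range_mapQ]
    exact (Submodule.ker_mapQ _ _ _ _).trans (by rw [Submodule.comap_id])

theorem Submodule.eq_of_le_of_length_quotient_eq {P Q : Submodule R M} (h : P ≤ Q)
    (hP : Module.length R (M ⧸ P) ≠ ⊤)
    (hPQ : Module.length R (M ⧸ P) = Module.length R (M ⧸ Q)) : P = Q := by
  have h1 := length_quotient_comap_add Q.subtype P (by simpa using h)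
  rw [Submodule.range_subtype, ← hPQ] at h1
  have h2 := ENat.add_left_injective_of_ne_top hP (h1.trans (zero_add _).symm)
  rw [Module.length_eq_zero_iff, Submodule.Quotient.subsingleton_iff,
    Submodule.comap_subtype_eq_top] at h2
  exact le_antisymm h h2

end QuotientLength

/-! ### Evaluation at a regular element in place of fractional ideals. -/

section Colon

open nonZeroDivisors

variable {R : Type*} [CommRing R] {x : R} {J : Ideal R}

/-- Both sides are `φ(xy)`. For regular `x` and values in `R`, `φ` is thus multiplication by the
fraction `φ(x)/x`. -/
theorem Ideal.mul_apply_eq_mul_apply {N : Type*} [AddCommGroup N] [Module R N] (φ : J →ₗ[R] N)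
    {y : R} (hx : x ∈ J) (hy : y ∈ J) : y • φ ⟨x, hx⟩ = x • φ ⟨y, hy⟩ := by
  rw [← map_smul, ← map_smul]
  congr 1
  ext
  exact mul_comm y x

/-- If multiplication by `a` maps `J` into `x K`, then `a / x` defines a homomorphism `J → K`. -/
theorem Ideal.exists_hom_of_mul_mem (hx : x ∈ R⁰) (hxJ : x ∈ J) {K : Ideal R} {a : R}
    (ha : ∀ y ∈ J, ∃ z ∈ K, x * z = a * y) :
    ∃ φ : J →ₗ[R] K, (φ ⟨x, hxJ⟩ : R) = a := by
  choose g hgK hg using ha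
  refine ⟨{ toFun y := ⟨g y y.2, hgK y y.2⟩
            map_add' y z := ?_
            map_smul' r y := ?_ }, ?_⟩
  · ext
    refine (mul_cancel_left_mem_nonZeroDivisors hx).mp ?_
    simp [hg, mul_add]
  · ext
    refine (mul_cancel_left_mem_nonZeroDivisors hx).mp ?_
    simp [hg, mul_left_comm x r]
    ring
  · refine (mul_cancel_left_mem_nonZeroDivisors hx).mp ?_
    rw [mul_comm x a]
    exact hg x hxJ

/-- Evaluation at `x` identifies `Hom(J, R)` with the colon ideal `(x) : J`. -/
theorem Ideal.range_applyₗ_eq_colon (hx : x ∈ R⁰) (hxJ : x ∈ J) :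
    LinearMap.range (LinearMap.applyₗ (R := R) (M₂ := R) (⟨x, hxJ⟩ : J)) =
      (Ideal.span {x}).colon (J : Set R) := by
  ext a
  rw [Submodule.mem_colon]
  constructor
  · rintro ⟨φ, rfl⟩ y hy
    rw [LinearMap.applyₗ_apply_apply, smul_eq_mul, mul_comm, ← smul_eq_mul,
      Ideal.mul_apply_eq_mul_apply φ hxJ hy, smul_eq_mul]
    exact Ideal.mul_mem_right _ _ (Ideal.mem_span_singleton_self x)
  · intro ha
    obtain ⟨φ, hφ⟩ := Ideal.exists_hom_of_mul_mem (K := ⊤) (a := a) hx hxJ fun y hy => by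
      obtain ⟨z, hz⟩ := Ideal.mem_span_singleton.mp (ha y hy)
      exact ⟨z, trivial, hz.symm⟩
    exact ⟨(Submodule.subtype ⊤).comp φ, hφ⟩

/-- The fraction `φ(x)/x` lies in `R` exactly when `φ(x) ∈ (x)`. So `R ⊆ J*` corresponds to `(x) ⊆
(x) : J`. -/
theorem Ideal.comap_applyₗ_span_singleton (hx : x ∈ R⁰) (hxJ : x ∈ J) :
    Submodule.comap (LinearMap.applyₗ (R := R) (M₂ := R) (⟨x, hxJ⟩ : J))
        (Ideal.span {x}) =
      LinearMap.range (LinearMap.lcomp R R (Submodule.subtype J)) := by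
  ext φ
  constructor
  · intro hφ
    obtain ⟨a, ha⟩ := Ideal.mem_span_singleton'.mp (Submodule.mem_comap.mp hφ)
    refine ⟨LinearMap.mulLeft R a, LinearMap.ext fun y => ?_⟩
    refine (mul_cancel_left_mem_nonZeroDivisors hx).mp ?_
    have := Ideal.mul_apply_eq_mul_apply φ hxJ y.2
    rw [LinearMap.applyₗ_apply_apply] at ha
    rw [← ha, smul_eq_mul, smul_eq_mul] at this
    simp only [LinearMap.lcomp_apply, Submodule.subtype_apply, LinearMap.mulLeft_apply]
    rw [← this]
    ring
  · rintro ⟨ψ, rfl⟩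
    refine Ideal.mem_span_singleton'.mpr ⟨ψ 1, ?_⟩
    simpa [mul_comm] using (ψ.map_smul x 1).symm

/-- Evaluation at `x` identifies `End(J)` with the colon ideal `x J : J`. -/
theorem Ideal.range_subtype_comp_applyₗ (hx : x ∈ R⁰) (hxJ : x ∈ J) :
    LinearMap.range ((Submodule.subtype J).comp
      (LinearMap.applyₗ (R := R) (M₂ := J) (⟨x, hxJ⟩ : J))) =
      (Ideal.span {x} * J).colon (J : Set R) := by
  ext a
  rw [Submodule.mem_colon]
  simp only [Ideal.mem_span_singleton_mul]
  constructor
  · rintro ⟨φ, rfl⟩ y hy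
    refine ⟨φ ⟨y, hy⟩, (φ ⟨y, hy⟩).2, ?_⟩
    have := congrArg Subtype.val (Ideal.mul_apply_eq_mul_apply φ hxJ hy)
    simpa [mul_comm] using this.symm
  · intro ha
    obtain ⟨φ, hφ⟩ := Ideal.exists_hom_of_mul_mem (K := J) (a := a) hx hxJ ha
    exact ⟨φ, hφ⟩

theorem Ideal.comap_subtype_comp_applyₗ (hx : x ∈ R⁰) (hxJ : x ∈ J) :
    Submodule.comap ((Submodule.subtype J).comp
      (LinearMap.applyₗ (R := R) (M₂ := J) (⟨x, hxJ⟩ : J))) (Ideal.span {x}) =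
      LinearMap.range (Algebra.linearMap R (Module.End R J)) := by
  ext φ
  constructor
  · intro hφ
    obtain ⟨a, ha⟩ := Ideal.mem_span_singleton'.mp (Submodule.mem_comap.mp hφ)
    refine ⟨a, LinearMap.ext fun y => Subtype.ext ?_⟩
    refine (mul_cancel_left_mem_nonZeroDivisors hx).mp ?_
    have := congrArg Subtype.val (Ideal.mul_apply_eq_mul_apply φ hxJ y.2)
    simp only [LinearMap.comp_apply, LinearMap.applyₗ_apply_apply, Submodule.subtype_apply] at ha
    simp only [Submodule.coe_smul, smul_eq_mul, ← ha] at this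
    simp only [Algebra.linearMap_apply, Module.algebraMap_end_apply, Submodule.coe_smul,
      smul_eq_mul]
    rw [← this]
    ring
  · rintro ⟨a, rfl⟩
    exact Ideal.mem_span_singleton'.mpr ⟨a, by simp⟩

end Colon

/-! ### The trace ideal and its dual. -/

section Trace

open nonZeroDivisors

variable {R : Type u} [CommRing R] {x : R} {I : Ideal R}

theorem apply_mem_traceIdeal {M : Type u} [AddCommGroup M] [Module R M] (φ : M →ₗ[R] R) (y : M) :
    φ y ∈ traceIdeal R M :=
  ⟨φ ⊗ₜ y, contractLeft_apply φ y⟩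

theorem traceIdeal_le {M : Type u} [AddCommGroup M] [Module R M] {K : Ideal R}
    (h : ∀ (φ : M →ₗ[R] R) (y : M), φ y ∈ K) : traceIdeal R M ≤ K := by
  rintro _ ⟨t, rfl⟩
  induction t with
  | zero => simp
  | tmul φ y => exact h φ y
  | add s t hs ht => rw [map_add]; exact K.add_mem hs ht

theorem le_traceIdeal (I : Ideal R) : I ≤ traceIdeal R I := fun y hy =>
  apply_mem_traceIdeal I.subtype ⟨y, hy⟩

/-- If `I` is reflexive, in the form `I = (x) : ((x) : I)`, then the dual of its trace ideal is its
endomorphism ring. -/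
theorem colon_traceIdeal (hx : x ∈ R⁰) (hxI : x ∈ I)
    (hrefl : (Ideal.span {x}).colon ((Ideal.span {x}).colon (I : Set R) : Set R) = I) :
    (Ideal.span {x}).colon (traceIdeal R I : Set R) = (Ideal.span {x} * I).colon (I : Set R) := by
  ext a
  rw [Submodule.mem_colon, Submodule.mem_colon]
  constructor
  · intro ha y hy
    obtain ⟨z, hz⟩ := Ideal.mem_span_singleton.mp (ha y (le_traceIdeal I hy))
    refine Ideal.mem_span_singleton_mul.mpr ⟨z, ?_, hz.symm⟩
    -- Here `z = ay/x`. By reflexivity it suffices that `φ(x) z ∈ (x)` for every `φ : I → R`; indeed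
    -- `φ(x) z = a φ(y)`, and `φ(y)` lies in the trace.
    rw [← hrefl, Submodule.mem_colon]
    intro b hb
    rw [SetLike.mem_coe, ← Ideal.range_applyₗ_eq_colon hx hxI] at hb
    obtain ⟨φ, rfl⟩ := hb
    obtain ⟨w, hw⟩ := Ideal.mem_span_singleton.mp (ha _ (apply_mem_traceIdeal φ ⟨y, hy⟩))
    refine Ideal.mem_span_singleton.mpr ⟨w, ?_⟩
    refine (mul_cancel_left_mem_nonZeroDivisors hx).mp ?_
    rw [← hw, LinearMap.applyₗ_apply_apply]
    have := Ideal.mul_apply_eq_mul_apply φ hxI hy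
    simp only [smul_eq_mul] at this hz ⊢
    rw [← mul_assoc, ← hz, mul_assoc, this]
    ring
  · intro ha
    change traceIdeal R I ≤ Submodule.comap (LinearMap.mulLeft R a) (Ideal.span {x})
    refine traceIdeal_le fun φ y => ?_
    -- With `ay = xz` and `z ∈ I`, linearity gives `a φ(y) = φ(xz) = x φ(z)`.
    obtain ⟨z, hz, hxz⟩ := Ideal.mem_span_singleton_mul.mp (ha y y.2)
    refine Ideal.mem_span_singleton.mpr ⟨φ ⟨z, hz⟩, ?_⟩
    have : a • y = x • (⟨z, hz⟩ : I) := Subtype.ext hxz.symm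
    rw [LinearMap.mulLeft_apply, ← smul_eq_mul, ← map_smul, this, map_smul, smul_eq_mul]

end Trace

/-! ### Duality for ideals of a one-dimensional Gorenstein local ring. -/

section Gorenstein

open nonZeroDivisors

variable {R : Type u} [CommRing R]

theorem isFiniteLength_quotient_of_mem [IsNoetherianRing R] [Ring.KrullDimLE 1 R] {x : R}
    (hx : x ∈ R⁰) {J : Ideal R} (hxJ : x ∈ J) : IsFiniteLength R (R ⧸ J) :=
  (isFiniteLength_quotient_span_singleton R hx).of_surjective
    (f := Submodule.factor (p := Ideal.span {x}) (p' := J) (by simpa [Ideal.span_le] using hxJ))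
    (Submodule.factor_surjective _)

variable [IsLocalRing R] [IsNoetherianRing R] [Ring.KrullDimLE 1 R]
  (hR : injectiveDimension (ModuleCat.of R R) ≠ ⊤) {x : R} (hx : x ∈ R⁰)
  {J : Ideal R} (hxJ : x ∈ J)

include hR hx hxJ

theorem subsingleton_ext_one_ideal :
    Subsingleton (Ext (ModuleCat.of R J) (ModuleCat.of R R) 1) := by
  refine subsingleton_ext_left (Submodule.injective_subtype J) (Submodule.mkQ_surjective J)
    (LinearMap.exact_subtype_mkQ J) _ 1 (subsingleton_ext_ring _ 0) ?_
  -- Local duality was proved for `x` in the maximal ideal; a unit `x` forces `J = R`, where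
  -- everything vanishes.
  by_cases hxu : IsUnit x
  · have : Subsingleton (R ⧸ J) :=
      Ideal.Quotient.subsingleton_iff.mpr (J.eq_top_of_isUnit_mem hxJ hxu)
    exact subsingleton_ext_of_subsingleton _ _ _
  · exact subsingleton_ext_add_two hR hx ((IsLocalRing.mem_maximalIdeal x).mpr hxu)
      (isFiniteLength_quotient_span_singleton R hx) (isFiniteLength_quotient_of_mem hx hxJ) 0

theorem length_dual_quotient :
    Module.length R ((J →ₗ[R] R) ⧸ LinearMap.range (LinearMap.lcomp R R (Submodule.subtype J))) =
      Module.length R (R ⧸ J) := by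
  rw [← length_ext_one_eq_length_lcomp_coker (Submodule.injective_subtype J)
    (Submodule.mkQ_surjective J) (LinearMap.exact_subtype_mkQ J) R (subsingleton_ext_ring _ 0)]
  by_cases hxu : IsUnit x
  · have : Subsingleton (R ⧸ J) :=
      Ideal.Quotient.subsingleton_iff.mpr (J.eq_top_of_isUnit_mem hxJ hxu)
    have := subsingleton_ext_of_subsingleton (R ⧸ J) (ModuleCat.of R R) 1
    simp
  · exact length_ext_one_eq hR hx ((IsLocalRing.mem_maximalIdeal x).mpr hxu)
      (isFiniteLength_quotient_span_singleton R hx) (isFiniteLength_quotient_of_mem hx hxJ)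

/-- `((x) : J)/(x)` is `J*/R`, whose length is `λ(R/J)`. -/
theorem length_quotient_add_length_quotient_colon :
    Module.length R (R ⧸ J) + Module.length R (R ⧸ (Ideal.span {x}).colon (J : Set R)) =
      Module.length R (R ⧸ Ideal.span {x}) := by
  have h := length_quotient_comap_add (LinearMap.applyₗ (R := R) (M₂ := R) (⟨x, hxJ⟩ : J))
    (Ideal.span {x}) (by
      rw [Ideal.range_applyₗ_eq_colon hx hxJ]
      exact Ideal.le_colon)
  rw [Ideal.comap_applyₗ_span_singleton hx hxJ, length_dual_quotient hR hx hxJ,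
    Ideal.range_applyₗ_eq_colon hx hxJ] at h
  exact h

/-- Ideals containing a regular element are reflexive. -/
theorem colon_colon_eq :
    (Ideal.span {x}).colon ((Ideal.span {x}).colon (J : Set R) : Set R) = J := by
  have hx' : x ∈ (Ideal.span {x}).colon (J : Set R) :=
    Ideal.le_colon (Ideal.mem_span_singleton_self x)
  have h1 := length_quotient_add_length_quotient_colon hR hx hxJ
  -- Applying the formula to `J` and to `(x) : J` shows that `J` and its double colon have equal
  -- finite colength; one contains the other.
  have h2 := length_quotient_add_length_quotient_colon hR hx hx'
  have hfin : Module.length R (R ⧸ (Ideal.span {x}).colon (J : Set R)) ≠ ⊤ :=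
    Module.length_ne_top_iff.mpr (isFiniteLength_quotient_of_mem hx hx')
  refine (Submodule.eq_of_le_of_length_quotient_eq ?_
    (Module.length_ne_top_iff.mpr (isFiniteLength_quotient_of_mem hx hxJ)) ?_).symm
  · intro y hy
    rw [Submodule.mem_colon]
    intro a ha
    rw [smul_eq_mul, mul_comm]
    exact Submodule.mem_colon.mp ha y hy
  · refine ENat.add_left_injective_of_ne_top hfin (h1.trans ?_)
    rw [← h2]
    exact add_comm _ _

/-- Evaluation at `x` sends `S/R` onto `((x) : tr J)/(x)`. Adding the colength of `(x) : tr J` to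
either side gives `λ(R/(x))`, and this finite colength cancels. -/
theorem length_endQuotient :
    Module.length R (EndQuotient R J) = Module.length R (R ⧸ traceIdeal R J) := by
  have hxt : x ∈ traceIdeal R J := le_traceIdeal J hxJ
  have h1 := length_quotient_add_length_quotient_colon hR hx hxt
  have h2 := length_quotient_comap_add ((Submodule.subtype J).comp
    (LinearMap.applyₗ (R := R) (M₂ := J) (⟨x, hxJ⟩ : J))) (Ideal.span {x}) (by
      rw [Ideal.range_subtype_comp_applyₗ hx hxJ, ← colon_traceIdeal hx hxJ
        (colon_colon_eq hR hx hxJ)]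
      exact Ideal.le_colon)
  rw [Ideal.comap_subtype_comp_applyₗ hx hxJ, Ideal.range_subtype_comp_applyₗ hx hxJ,
    ← colon_traceIdeal hx hxJ (colon_colon_eq hR hx hxJ), ← h1] at h2
  refine ENat.add_left_injective_of_ne_top (Module.length_ne_top_iff.mpr
    (isFiniteLength_quotient_of_mem hx (Ideal.le_colon (Ideal.mem_span_singleton_self x)))) h2

theorem length_ext_one_add_length_quotient :
    Module.length R (Ext (ModuleCat.of R J) (ModuleCat.of R J) 1) + Module.length R (R ⧸ J) =
      Module.length R (EndQuotient R J) + Module.length R (J →ₗ[R] R ⧸ J) := by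
  let π : (J →ₗ[R] R) →ₗ[R] (J →ₗ[R] R ⧸ J) := LinearMap.compRight R (Submodule.mkQ J)
  let ι : Module.End R J →ₗ[R] (J →ₗ[R] R) := LinearMap.compRight R (Submodule.subtype J)
  have hext := length_ext_one_eq_length_compRight_coker (Submodule.injective_subtype J)
    (Submodule.mkQ_surjective J) (LinearMap.exact_subtype_mkQ J) J
    (subsingleton_ext_one_ideal hR hx hxJ)
  have hπ : Module.length R (J →ₗ[R] R ⧸ J) = Module.length R (LinearMap.range π) +
      Module.length R ((J →ₗ[R] R ⧸ J) ⧸ LinearMap.range π) :=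
    Module.length_eq_add_of_exact (LinearMap.range π).subtype (LinearMap.range π).mkQ
      (Submodule.injective_subtype _) (Submodule.mkQ_surjective _) (LinearMap.exact_subtype_mkQ _)
  have hι : LinearMap.range ι = LinearMap.ker π := by
    ext φ
    constructor
    · rintro ⟨f, rfl⟩
      refine LinearMap.ext fun y => ?_
      exact Ideal.Quotient.eq_zero_iff_mem.mpr (f y).2
    · intro hφ
      refine ⟨φ.codRestrict J fun y => ?_, rfl⟩
      exact Ideal.Quotient.eq_zero_iff_mem.mp (LinearMap.congr_fun hφ y)
  have hle : LinearMap.range (LinearMap.lcomp R R (Submodule.subtype J)) ≤ LinearMap.range ι := by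
    rintro _ ⟨ψ, rfl⟩
    refine ⟨algebraMap R _ (ψ 1), LinearMap.ext fun y => ?_⟩
    simpa [ι, mul_comm] using (ψ.map_smul (y : R) 1).symm
  have hcomap : Submodule.comap ι (LinearMap.range (LinearMap.lcomp R R (Submodule.subtype J))) =
      LinearMap.range (Algebra.linearMap R (Module.End R J)) := by
    rw [← Ideal.comap_applyₗ_span_singleton hx hxJ, ← Ideal.comap_subtype_comp_applyₗ hx hxJ]
    rfl
  -- The chain `R ⊆ S ⊆ J*`: `λ(S/R) + λ(J*/S) = λ(J*/R)`.
  have hs := length_quotient_comap_add ι _ hle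
  rw [hcomap, length_dual_quotient hR hx hxJ, hι] at hs
  have hker : Module.length R ((J →ₗ[R] R) ⧸ LinearMap.ker π) =
      Module.length R (LinearMap.range π) := LinearEquiv.length_eq π.quotKerEquivRange
  rw [hker] at hs
  rw [hext, ← hs, hπ]
  change Module.length R ((J →ₗ[R] R ⧸ J) ⧸ LinearMap.range π) + _ = _
  ac_rfl

end Gorenstein

/-! ### Passage between `R` and `R/I`. -/

section CanonicalModule

variable {R : Type u} [CommRing R] {I : Ideal R}

theorem IsFiniteLength.restrictScalars_quotient {M : Type*} [AddCommGroup M] [Module R M]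
    [Module (R ⧸ I) M] [IsScalarTower R (R ⧸ I) M] (h : IsFiniteLength (R ⧸ I) M) :
    IsFiniteLength R M := by
  rw [← Module.length_ne_top_iff] at h ⊢
  rwa [Module.length_eq_of_surjective (R := R ⧸ I) (S := R) Ideal.Quotient.mk_surjective]

theorem Ideal.finite_cotangent_quotient [IsNoetherianRing R] (I : Ideal R) :
    Module.Finite (R ⧸ I) I.Cotangent :=
  have : Module.Finite R I.Cotangent := .of_surjective I.toCotangent I.toCotangent_surjective
  Module.Finite.of_restrictScalars_finite R (R ⧸ I) I.Cotangent

theorem isArtinianRing_quotient (hI : IsFiniteLength R (R ⧸ I)) : IsArtinianRing (R ⧸ I) := by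
  have := (isFiniteLength_iff_isNoetherian_isArtinian.mp hI).2
  exact isArtinian_of_tower R this

/-- Tensor products of `R / I`-modules may be computed over `R`. -/
noncomputable def tensorProductQuotientEquiv (M N : Type*) [AddCommGroup M] [Module R M]
    [Module (R ⧸ I) M] [IsScalarTower R (R ⧸ I) M] [AddCommGroup N] [Module R N]
    [Module (R ⧸ I) N] [IsScalarTower R (R ⧸ I) N] :
    TensorProduct (R ⧸ I) M N ≃ₗ[R] TensorProduct R M N :=
  have : TensorProduct.CompatibleSMul R (R ⧸ I) M N :=
    .of_algebraMap_surjective _ _ Ideal.Quotient.mk_surjective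
  (TensorProduct.equivOfCompatibleSMul (R ⧸ I) R R M N).symm

variable [IsNoetherianRing R] {ω : Type u} [AddCommGroup ω] [Module (R ⧸ I) ω]

theorem IsCanonicalModule.isFiniteLength_tensorProduct (hω : IsCanonicalModule (R ⧸ I) ω)
    (hI : IsFiniteLength R (R ⧸ I)) :
    IsFiniteLength R (TensorProduct (R ⧸ I) I.Cotangent ω) := by
  have := isArtinianRing_quotient hI
  have := hω.finite
  have := I.finite_cotangent_quotient
  exact (isFiniteLength_of_finite (R ⧸ I) _).restrictScalars_quotient

theorem IsCanonicalModule.length_hom_quotient [IsLocalRing R] (hω : IsCanonicalModule (R ⧸ I) ω)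
    (hI : IsFiniteLength R (R ⧸ I)) :
    Module.length R (I →ₗ[R] R ⧸ I) =
      Module.length R (TensorProduct (R ⧸ I) I.Cotangent ω) := by
  rw [← (cotangentDualEquiv I).length_eq,
    Module.length_eq_of_surjective (R := R ⧸ I) (S := R) Ideal.Quotient.mk_surjective,
    Module.length_eq_of_surjective (R := R ⧸ I) (S := R) Ideal.Quotient.mk_surjective]
  have := isArtinianRing_quotient hI
  -- For `I = R` the quotient is not a local ring, but both lengths are zero.
  rcases subsingleton_or_nontrivial (R ⧸ I) with h | h
  · simp
  · have : IsLocalRing (R ⧸ I) := .of_surjective' _ Ideal.Quotient.mk_surjective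
    have := I.finite_cotangent_quotient
    exact hω.length_dual_eq_length_tensorProduct I.Cotangent

end CanonicalModule

/-! ### Assembly of the length formula and the rigidity criteria. -/

theorem proposition4p8 (R : Type u) [CommRing R] [IsGorensteinLocalRing R]
    (hdim : ringKrullDim R = 1) (I : Ideal R) (hI : ∃ x ∈ I, x ∈ nonZeroDivisors R)
    (ω : Type u) [AddCommGroup ω] [Module R ω] [Module (R ⧸ I) ω] [IsScalarTower R (R ⧸ I) ω]
    (hω : IsCanonicalModule (R ⧸ I) ω) :
    -- all the modules involved have finite length
    (IsFiniteLength R (Ext (ModuleCat.of R I) (ModuleCat.of R I) 1) ∧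
      IsFiniteLength R (R ⧸ I) ∧
      IsFiniteLength R (EndQuotient R I) ∧
      IsFiniteLength R (TensorProduct (R ⧸ I) I.Cotangent ω) ∧
      IsFiniteLength R (TensorProduct R I.Cotangent ω) ∧
      IsFiniteLength R (traceIdeal R I ⧸ I.submoduleOf (traceIdeal R I))) ∧
    Module.length R (Ext (ModuleCat.of R I) (ModuleCat.of R I) 1) + Module.length R (R ⧸ I) =
      Module.length R (EndQuotient R I) +
        Module.length R (TensorProduct (R ⧸ I) I.Cotangent ω) ∧
    (IsRigidModule R I ↔
      ((Module.length R (R ⧸ I)).toNat : ℤ) - ((Module.length R (EndQuotient R I)).toNat : ℤ) =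
        ((Module.length R (TensorProduct (R ⧸ I) I.Cotangent ω)).toNat : ℤ)) ∧
    I ≤ traceIdeal R I ∧
    (IsRigidModule R I ↔
      Module.length R (traceIdeal R I ⧸ I.submoduleOf (traceIdeal R I)) =
        Module.length R (TensorProduct R I.Cotangent ω)) := by
  obtain ⟨hloc, hnoeth, hR⟩ := ‹IsGorensteinLocalRing R›
  obtain ⟨x, hxI, hx⟩ := hI
  have : Ring.KrullDimLE 1 R := (Order.krullDimLE_iff _ _).mpr hdim.le
  have hRI : IsFiniteLength R (R ⧸ I) := isFiniteLength_quotient_of_mem hx hxI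
  have hten := hω.isFiniteLength_tensorProduct hRI
  have heq := length_ext_one_add_length_quotient hR hx hxI
  rw [hω.length_hom_quotient hRI] at heq
  have htr : Module.length R (traceIdeal R I ⧸ I.submoduleOf (traceIdeal R I)) +
      Module.length R (EndQuotient R I) = Module.length R (R ⧸ I) := by
    have h := length_quotient_comap_add (Submodule.subtype (traceIdeal R I)) I
      (by simpa using le_traceIdeal I)
    rw [Submodule.range_subtype, ← length_endQuotient hR hx hxI] at h
    exact h
  have hrig : IsRigidModule R I ↔
      Module.length R (Ext (ModuleCat.of R I) (ModuleCat.of R I) 1) = 0 :=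
    Module.length_eq_zero_iff.symm
  have hten' := (tensorProductQuotientEquiv (I := I) I.Cotangent ω).length_eq
  rw [hrig, ← hten']
  simp only [← Module.length_ne_top_iff] at hRI hten ⊢
  rw [← hten']
  generalize Module.length R (Ext (ModuleCat.of R I) (ModuleCat.of R I) 1) = e at *
  generalize Module.length R (EndQuotient R I) = s at *
  generalize Module.length R (traceIdeal R I ⧸ I.submoduleOf (traceIdeal R I)) = t at *
  generalize Module.length R (TensorProduct (R ⧸ I) I.Cotangent ω) = h at *
  generalize Module.length R (R ⧸ I) = a at *
  have hs : s ≠ ⊤ := fun hs => hRI (by rw [← htr, hs, add_top])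
  have ht : t ≠ ⊤ := fun ht => hRI (by rw [← htr, ht, top_add])
  -- Finiteness of `Ext¹(I, I)` is read off from the length formula, whose right side is finite.
  have he : e ≠ ⊤ := fun he => by
    rw [he, top_add] at heq
    exact (ENat.add_lt_top.mpr ⟨hs.lt_top, hten.lt_top⟩).ne heq.symm
  lift a to ℕ using hRI
  lift s to ℕ using hs
  lift t to ℕ using ht
  lift e to ℕ using he
  lift h to ℕ using hten
  norm_cast at heq htr
  refine ⟨by simp, mod_cast heq, ?_, le_traceIdeal I, ?_⟩
  · simp only [ENat.toNat_natCast, Nat.cast_eq_zero]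
    lia
  · norm_cast
    lia
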